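/- **Conventions.** Graphs are finite and simple. A *near-triangulation* is a connected graph drawn in the plane (here with at least one edge) in which every finite region is bounded by a triangle. A *configuration* $K$ is a near-triangulation $G(K)$ with a map $\gamma_K:V(G(K))\to\mathbb Z$ such that: (i) for each $v$, $G(K)\setminus v$ has at most two components, and $\gamma_K(v)=d(v)+2$ if it has two; (ii) $\gamma_K(v)=d(v)$ if $v$ is not incident with the infinite region, $\gamma_K(v)>d(v)$ otherwise, and always $\gamma_K(v)\ge 5$; (iii) $\sum(\gamma_K(v)-d(v)-1)\ge2$, summed over the vertices $v$ incident with the infinite region for which $G(K)\setminus v$ is connected. A *cartwheel* with *hub* $w$ is a configuration $W$ whose vertices other than $w$ are those of two disjoint induced circuits $C_1,C_2$, where $C_2$ bounds the infinite region and $w$ is adjacent to all of $C_1$ and to nothing in $C_2$. Its *spokes* are the vertices of $C_1$, its *hats* are the vertices of $C_2$ adjacent to two spokes, and its *fans* are the other vertices of $C_2$. $W$ is *compatible with the trivial axle $\Omega_d$* if $\gamma_W(w)=d$, its hub, spokes $1,\dots,d$ (in clockwise order) and hats $d+1,\dots,2d$ (the hat $d+i$ being adjacent to the spokes $i$ and $i+1$,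 and $2d$ to $d$ and $1$) are pairwise distinct vertices, and $5\le\gamma_W(v)\le12$ for each spoke and hat $v$. A *pass* $P=(K,r,s,t)$ is a configuration $K$ with a value $r=r(P)\ge1$ and adjacent vertices $s=s(P)$, $t=t(P)$ of $G(K)$. It *appears* in $W$ if $K$ is an induced subconfiguration of $W$ all of whose finite regions are finite regions of $W$. A *rule* is a tuple $R=(G,\beta,\delta,r,s,t)$ with $G$ a near-triangulation, $\beta:V(G)\to\mathbb N$, $\delta:V(G)\to\mathbb N\cup\{\infty\}$, $r\ge1$, and $s,t$ adjacent. $P$ *obeys* $R$ if some homeomorphism $h$ of the plane maps $G(K)$ to $G$, source to source and sink to sink, the values agree, and $\beta(h(v))\le\gamma_K(v)\le\delta(h(v))$ for all $v\in V(G(K))$; it *orientation-obeys* (*anti-orientation-obeys*) $R$ if $h$ can be chosen orientation-preserving (orientation-reversing). $R$ is *coherent* if (i) whenever $P$ obeys $R$ (via $h$) and appears in a cartwheel $W$ with $s(P)$ or $t(P)$ equal to the hub, and $v\in V(P)$ is a fan of $W$ adjacent to the spoke $u$, then $u\in V(P)$ and $\beta(h(u))=\delta(h(u))$; and (ii) if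 some pass both orientation-obeys and anti-orientation-obeys $R$, then every pass that orientation-obeys $R$ also anti-orientation-obeys $R$. A coherent rule is *symmetric* if some pass both orientation-obeys and anti-orientation-obeys it. **Construction.** Let $\mathcal P$ be a finite list of rules. Let $\mathcal R'$ be obtained from $\mathcal P$ by replacing each non-coherent rule by two coherent rules with the same net effect. Here two rules have the same net effect as $R$ if, for every $K$ and adjacent $s,t$, the value contributed by $R$ (namely $r(R)$ if $(K,r(R),s,t)$ obeys $R$, and $0$ otherwise) is the sum of the values contributed by the two rules. Let $\mathcal R''$ be $\mathcal R'$ together with, for each non-symmetric $(G,\beta,\delta,r,s,t)\in\mathcal R'$, the rule $(G^*,\beta,\delta,r,s,t)$, where $G^*$ is the mirror image of $G$. Let $\mathcal R'''$ be obtained from $\mathcal R''$ by replacing each rule of value $r$ by $r$ identical rules of value one. Finally, let $\mathcal R$ be obtained from $\mathcal R'''$ by replacing each $\delta$ by $\min\{\delta,12\}$. ($\mathcal R$ is a list: identical rules are repeated.) **Theorem.** Let $\mathcal P$, $\mathcal R'$, $\mathcal R$ be as above. Let $5\le d\le 12$, let $W$ be a cartwheel compatible with $\Omega_d$, let $w$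 be its hub and $s$ a spoke. Assume that $\gamma_W(v)\le12$ for every fan $v$ of $W$ that belongs to a pass that obeys a member of $\mathcal P$ and appears in $W$ with source and sink $s,w$ or $w,s$. Then, for $(x,y)=(s,w)$ and for $(x,y)=(w,s)$, $$\sum_{R\in\mathcal R}\ \sum\bigl(r(P): P \text{ orientation-obeys } R,\ P\text{ appears in }W,\ s(P)=x,\ t(P)=y\bigr)=\sum_{R\in\mathcal P}\ \sum\bigl(r(P): P \text{ obeys } R,\ P\text{ appears in }W,\ s(P)=x,\ t(P)=y\bigr).$$ If moreover no pass obeys two different members of the list $\mathcal P$, then for both choices of $(x,y)$ the left side also equals $\sum(r(P): P$ obeys some member of $\mathcal P$, $P$ appears in $W$, $s(P)=x$, $t(P)=y)$, each pass being counted once. -/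

import Mathlib

namespace Discharging

/-! ## Near-triangulations, as rotation systems on the sphere -/

/-- The permutation of the darts of a simple graph that reverses every dart. -/
def dartRev {V : Type} (G : SimpleGraph V) : Equiv.Perm G.Dart where
  toFun d := d.symm
  invFun d := d.symm
  left_inv d := d.symm_symm
  right_inv d := d.symm_symm

/-- A near-triangulation with at least one edge: a finite connected simple graph drawn in the plane
such that every finite region is bounded by a triangle.  The drawing is given, up to an
orientation-preserving homeomorphism of the plane, by its rotation system and its infinite region.
`rot d` is the dart that follows `d` in the clockwise order around the vertex `d.fst`.  The regions
are the orbits of `d ↦ rot (reverse of d)`: the orbit of `d` traces the boundary of the region on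
the left of `d`.  By Euler's formula `|V| - |E| + |F| = 2` the surface is the sphere. -/
structure NearTriangulation where
  V : Type
  finite : Finite V
  graph : SimpleGraph V
  connected : graph.Connected
  rot : Equiv.Perm graph.Dart
  rot_sameCycle : ∀ a b, rot.SameCycle a b ↔ a.fst = b.fst
  euler : 2 * Nat.card V
      + 2 * Nat.card (Quotient (Equiv.Perm.SameCycle.setoid (rot * dartRev graph)))
      = Nat.card graph.Dart + 4
  /-- the darts that have the infinite region on their left -/
  outer : Set graph.Dart
  outer_region : ∃ a, ∀ b, b ∈ outer ↔ (rot * dartRev graph).SameCycle a b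
  triangles : ∀ d, d ∉ outer → ((rot * dartRev graph) ^ 3) d = d

attribute [instance] NearTriangulation.finite

namespace NearTriangulation

/-- The permutation of the darts whose orbits are the boundaries of the regions. -/
def next (G : NearTriangulation) : Equiv.Perm G.graph.Dart := G.rot * dartRev G.graph

/-- The degree of a vertex in the graph. -/
noncomputable def deg (G : NearTriangulation) (v : G.V) : ℕ := (G.graph.neighborSet v).ncard

/-- The vertex `v` is incident with the infinite region. -/
def OnOuter (G : NearTriangulation) (v : G.V) : Prop := ∃ d ∈ G.outer, d.fst = v

/-- The graph obtained by deleting a vertex. -/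
def del (G : NearTriangulation) (v : G.V) : SimpleGraph ({v}ᶜ : Set G.V) := G.graph.induce {v}ᶜ

theorem mirror_next {V : Type} (G : SimpleGraph V) (rot : Equiv.Perm G.Dart) :
    rot⁻¹ * dartRev G = dartRev G * (rot * dartRev G)⁻¹ * (dartRev G)⁻¹ := by
  have h : (dartRev G)⁻¹ = dartRev G := by ext1 d; rfl
  have h2 : dartRev G * dartRev G = 1 := by
    ext1 d; exact d.symm_symm
  rw [mul_inv_rev, h, ← mul_assoc, h2, one_mul]

theorem mirror_sameCycle {V : Type} (G : SimpleGraph V) (rot : Equiv.Perm G.Dart) (a b : G.Dart) :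
    (rot⁻¹ * dartRev G).SameCycle a b ↔ (rot * dartRev G).SameCycle a.symm b.symm := by
  rw [mirror_next, Equiv.Perm.sameCycle_conj, Equiv.Perm.sameCycle_inv]
  rfl

/-- The mirror image of a near-triangulation: the same graph with the opposite orientation. -/
def mirror (G : NearTriangulation) : NearTriangulation where
  V := G.V
  finite := G.finite
  graph := G.graph
  connected := G.connected
  rot := G.rot⁻¹
  rot_sameCycle a b := by rw [Equiv.Perm.sameCycle_inv]; exact G.rot_sameCycle a b
  euler := by
    rw [← G.euler]
    congr 2
    refine Nat.card_congr (Quotient.congr (dartRev G.graph) ?_)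
    intro a b
    exact mirror_sameCycle G.graph G.rot a b
  outer := {d | d.symm ∈ G.outer}
  outer_region := by
    obtain ⟨a, ha⟩ := G.outer_region
    refine ⟨a.symm, fun b => ?_⟩
    rw [mirror_sameCycle, SimpleGraph.Dart.symm_symm]
    exact ha b.symm
  triangles d hd := by
    have h := G.triangles d.symm hd
    rw [mirror_next, conj_pow, inv_pow]
    have h' : ((G.rot * dartRev G.graph) ^ 3)⁻¹ d.symm = d.symm := by
      rw [Equiv.Perm.inv_eq_iff_eq]; exact h.symm
    change (((G.rot * dartRev G.graph) ^ 3)⁻¹ d.symm).symm = d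
    rw [h', SimpleGraph.Dart.symm_symm]

/-- The graph isomorphism `h` is induced by an orientation-preserving homeomorphism of the plane
mapping the drawing `G` to the drawing `H`. -/
def OrientIso {G H : NearTriangulation} (h : G.graph ≃g H.graph) : Prop :=
  (∀ d, H.rot (h.toHom.mapDart d) = h.toHom.mapDart (G.rot d)) ∧
  (∀ d, h.toHom.mapDart d ∈ H.outer ↔ d ∈ G.outer)

/-- The graph isomorphism `h` is induced by an orientation-reversing homeomorphism of the plane
mapping the drawing `G` to the drawing `H`. -/
def AntiIso {G H : NearTriangulation} (h : G.graph ≃g H.graph) : Prop :=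
  OrientIso (G := G.mirror) (H := H) h

end NearTriangulation

/-! ## Configurations and cartwheels -/

/-- A configuration: a near-triangulation `G` with a map `γ` on its vertices ("intended degree")
satisfying the three conditions below. -/
structure Configuration where
  G : NearTriangulation
  γ : G.V → ℕ
  /-- at most two components remain after deleting `v`; if there are two, then `γ v = d(v) + 2` -/
  components : ∀ v, Nat.card (G.del v).ConnectedComponent ≤ 2 ∧
    (Nat.card (G.del v).ConnectedComponent = 2 → γ v = G.deg v + 2)
  /-- `γ v = d(v)` if `v` is not incident with the infinite region, `γ v > d(v)` if it is -/
  degrees : ∀ v, (¬ G.OnOuter v → γ v = G.deg v) ∧ (G.OnOuter v → G.deg v < γ v) ∧ 5 ≤ γ v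
  /-- the ring-size is at least two -/
  ringSize : 2 ≤ ∑ᶠ v ∈ {v | G.OnOuter v ∧ (G.del v).Connected}, (γ v - G.deg v - 1)

/-- The vertex set `S` induces a circuit in `G`. -/
def IsInducedCircuit {V : Type} (G : SimpleGraph V) (S : Set V) : Prop :=
  ∃ n, 3 ≤ n ∧ Nonempty (G.induce S ≃g SimpleGraph.cycleGraph n)

/-- `W` is a cartwheel with hub `w`: apart from `w`, the vertices of `W` are those of two disjoint
induced circuits `C₁` and `C₂`, where `C₂` bounds the infinite region and `w` is adjacent to all
vertices of `C₁` and to no vertex of `C₂`. -/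
def IsCartwheel (W : Configuration) (w : W.G.V) : Prop :=
  ∃ C₁ C₂ : Set W.G.V,
    w ∉ C₁ ∧ w ∉ C₂ ∧ Disjoint C₁ C₂ ∧ {w} ∪ C₁ ∪ C₂ = Set.univ ∧
    IsInducedCircuit W.G.graph C₁ ∧ IsInducedCircuit W.G.graph C₂ ∧
    (∀ d : W.G.graph.Dart, (d.fst ∈ C₂ ∧ d.snd ∈ C₂) ↔ (d ∈ W.G.outer ∨ d.symm ∈ W.G.outer)) ∧
    (∀ v ∈ C₁, W.G.graph.Adj w v) ∧ (∀ v ∈ C₂, ¬ W.G.graph.Adj w v)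

/-- A spoke of a cartwheel with hub `w` is a neighbour of the hub. -/
def IsSpoke (W : Configuration) (w v : W.G.V) : Prop := W.G.graph.Adj w v

/-- A hat of a cartwheel with hub `w` is a vertex other than the hub and the spokes that is adjacent
to two spokes. -/
def IsHat (W : Configuration) (w v : W.G.V) : Prop :=
  v ≠ w ∧ ¬ IsSpoke W w v ∧
    ∃ a b, a ≠ b ∧ IsSpoke W w a ∧ IsSpoke W w b ∧ W.G.graph.Adj v a ∧ W.G.graph.Adj v b

/-- The fans of a cartwheel with hub `w` are the remaining vertices; a fan is adjacent to exactly one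
spoke. -/
def IsFan (W : Configuration) (w v : W.G.V) : Prop :=
  v ≠ w ∧ ¬ IsSpoke W w v ∧ ¬ IsHat W w v

/-! ## Axles -/

/-- An axle of degree `d`; only the values at `1, …, 5d` matter. -/
structure Axle (d : ℕ) where
  l : ℕ → ℕ
  u : ℕ → ℕ
  le : ∀ i, 1 ≤ i → i ≤ 5 * d → l i ≤ u i
  lower : ∀ i, 1 ≤ i → i ≤ 5 * d → l i ∈ ({5, 6, 7, 8, 9} : Set ℕ)
  upper : ∀ i, 1 ≤ i → i ≤ 5 * d → u i ∈ ({5, 6, 7, 8, 12} : Set ℕ)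
  fans : ∀ i, 1 ≤ i → i ≤ d → l i ≠ u i → ∀ j, 2 ≤ j → j ≤ 4 →
    l (j * d + i) = 5 ∧ u (j * d + i) = 12

/-- The trivial axle `Ω_d`. -/
def trivialAxle (d : ℕ) : Axle d where
  l _ := 5
  u _ := 12
  le _ _ _ := by norm_num
  lower _ _ _ := by norm_num
  upper _ _ _ := by norm_num
  fans _ _ _ _ _ _ _ := ⟨rfl, rfl⟩

/-- The vertices, other than the hub `0`, of the part derived from the axle `A`: the spokes
`1, …, d`, the hats `d + 1, …, 2d`, and the fans `jd + i`, `2 ≤ j ≤ l i - 4`, over those spokes `i`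
for which `l i = u i`. -/
def Axle.positions {d : ℕ} (A : Axle d) : Set ℕ :=
  {n | 1 ≤ n ∧ n ≤ 2 * d} ∪
  {n | ∃ i j, 1 ≤ i ∧ i ≤ d ∧ A.l i = A.u i ∧ 2 ≤ j ∧ j + 4 ≤ A.l i ∧ n = j * d + i}

/-- The cyclic successor in `1, …, d`. -/
def cycSucc (d i : ℕ) : ℕ := if i = d then 1 else i + 1

/-- The cartwheel `W` with hub `w` is compatible with the axle `A`: with a suitable naming `lab` of
its vertices by integers it satisfies the conditions on the part derived from `A`. -/
def Compatible {d : ℕ} (W : Configuration) (w : W.G.V) (A : Axle d) : Prop :=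
  ∃ lab : ℕ → W.G.V,
    lab 0 = w ∧ W.γ w = d ∧ Set.InjOn lab (insert 0 A.positions) ∧
    -- the spokes are `1, …, d` in clockwise order
    (∀ v, IsSpoke W w v ↔ ∃ i, 1 ≤ i ∧ i ≤ d ∧ lab i = v) ∧
    (∀ i, 1 ≤ i → i ≤ d → ∃ a : W.G.graph.Dart,
      a.fst = w ∧ a.snd = lab i ∧ (W.G.rot a).snd = lab (cycSucc d i)) ∧
    -- the hats are `d + 1, …, 2d` in order
    (∀ v, IsHat W w v ↔ ∃ i, 1 ≤ i ∧ i ≤ d ∧ lab (d + i) = v) ∧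
    (∀ i, 1 ≤ i → i ≤ d → W.G.graph.Adj (lab (d + i)) (lab i) ∧
      W.G.graph.Adj (lab (d + i)) (lab (cycSucc d i))) ∧
    -- if `k = l i = u i`, the fans over `i` are `2d + i, 3d + i, …, (k - 4)d + i`, and these
    -- vertices followed by `d + i` form a path
    (∀ i, 1 ≤ i → i ≤ d → A.l i = A.u i →
      (∀ v, (IsFan W w v ∧ W.G.graph.Adj v (lab i)) ↔
        ∃ j, 2 ≤ j ∧ j + 4 ≤ A.l i ∧ lab (j * d + i) = v) ∧
      (∀ j, 2 ≤ j → j + 5 ≤ A.l i →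
        W.G.graph.Adj (lab (j * d + i)) (lab ((j + 1) * d + i))) ∧
      (6 ≤ A.l i → W.G.graph.Adj (lab ((A.l i - 4) * d + i)) (lab (d + i)))) ∧
    -- the bounds
    (∀ n ∈ A.positions, A.l n ≤ W.γ (lab n) ∧ W.γ (lab n) ≤ A.u n)

/-! ## Passes and rules -/

/-- A pass: a configuration `K`, a value `r`, and two adjacent vertices, the source `s` and the
sink `t`. -/
structure Pass where
  K : Configuration
  r : ℕ+
  s : K.G.V
  t : K.G.V
  adj : K.G.graph.Adj s t

/-- A rule `(G, β, δ, r, s, t)`.  No further restrictions (such as `β ≤ δ`, or a bound on distances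
in `G`) are imposed; they only single out smaller classes of rules. -/
structure Rule where
  G : NearTriangulation
  β : G.V → ℕ
  δ : G.V → ℕ∞
  r : ℕ+
  s : G.V
  t : G.V
  adj : G.graph.Adj s t

/-- The graph isomorphism `h` maps source to source and sink to sink, the values agree, and the
degrees in the pass are within the bounds of the rule. -/
def Pass.Fits (P : Pass) (R : Rule) (h : P.K.G.graph ≃g R.G.graph) : Prop :=
  P.r = R.r ∧ h P.s = R.s ∧ h P.t = R.t ∧
    ∀ v, R.β (h v) ≤ P.K.γ v ∧ (P.K.γ v : ℕ∞) ≤ R.δ (h v)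

/-- The pass `P` orientation-obeys the rule `R`. -/
def Pass.OrientObeys (P : Pass) (R : Rule) : Prop :=
  ∃ h : P.K.G.graph ≃g R.G.graph, NearTriangulation.OrientIso h ∧ P.Fits R h

/-- The pass `P` anti-orientation-obeys the rule `R`. -/
def Pass.AntiObeys (P : Pass) (R : Rule) : Prop :=
  ∃ h : P.K.G.graph ≃g R.G.graph, NearTriangulation.AntiIso h ∧ P.Fits R h

/-- The pass `P` obeys the rule `R`. -/
def Pass.Obeys (P : Pass) (R : Rule) : Prop := P.OrientObeys R ∨ P.AntiObeys R

/-- The embedding `e` makes `K` an induced subconfiguration of `W`: `G(K)` is an induced subdrawing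
of `G(W)` (the clockwise successor of a dart in `K` is the first dart of `K` that follows it
clockwise in `W`), the finite regions of `K` are finite regions of `W`, and `γ_K` is the restriction
of `γ_W`. -/
def IsInducedSub (K W : Configuration) (e : K.G.graph ↪g W.G.graph) : Prop :=
  (∀ v, K.γ v = W.γ (e v)) ∧
  (∀ d, ∃ n, 0 < n ∧ (W.G.rot ^ n) (e.toHom.mapDart d) = e.toHom.mapDart (K.G.rot d) ∧
    ∀ m, 0 < m → m < n → (W.G.rot ^ m) (e.toHom.mapDart d) ∉ Set.range e.toHom.mapDart) ∧
  (∀ d, d ∉ K.G.outer → e.toHom.mapDart d ∉ W.G.outer ∧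
    W.G.next (e.toHom.mapDart d) = e.toHom.mapDart (K.G.next d))

/-- The pass `P` appears in `W` on the set of vertices `X`, with source `x` and sink `y`. -/
def Pass.AppearsOn (P : Pass) (W : Configuration) (X : Set W.G.V) (x y : W.G.V) : Prop :=
  ∃ e : P.K.G.graph ↪g W.G.graph, IsInducedSub P.K W e ∧ Set.range e = X ∧ e P.s = x ∧ e P.t = y

/-- The sum of the values `r(P)` of all passes `P` with property `p` that appear in `W` with source
`x` and sink `y`.  Such a pass is an induced subconfiguration of `W` together with a value and the
ends `x`, `y`, so it is given by its set of vertices `X` and its value. -/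
noncomputable def passSum (W : Configuration) (x y : W.G.V) (p : Pass → Prop) : ℕ :=
  ∑ᶠ q ∈ {q : Set W.G.V × ℕ+ | ∃ P : Pass, p P ∧ P.r = q.2 ∧ P.AppearsOn W q.1 x y}, (q.2 : ℕ)

/-! ## Coherence, and the modified rules -/

/-- Coherent rules. -/
def Rule.Coherent (R : Rule) : Prop :=
  (∀ (W : Configuration) (w : W.G.V), IsCartwheel W w →
    ∀ (P : Pass) (h : P.K.G.graph ≃g R.G.graph),
      (NearTriangulation.OrientIso h ∨ NearTriangulation.AntiIso h) → P.Fits R h →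
    ∀ e : P.K.G.graph ↪g W.G.graph, IsInducedSub P.K W e → (e P.s = w ∨ e P.t = w) →
    ∀ v, IsFan W w (e v) → ∀ u, IsSpoke W w u → W.G.graph.Adj u (e v) →
      ∃ u' : P.K.G.V, e u' = u ∧ (R.β (h u') : ℕ∞) = R.δ (h u')) ∧
  ((∃ P : Pass, P.OrientObeys R ∧ P.AntiObeys R) → ∀ P : Pass, P.OrientObeys R → P.AntiObeys R)

/-- Symmetric rules (the notion is used for coherent rules). -/
def Rule.Symmetric (R : Rule) : Prop := ∃ P : Pass, P.OrientObeys R ∧ P.AntiObeys R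

/-- The rule `(G*, β, δ, r, s, t)`, where `G*` is the mirror image of `G`. -/
def Rule.mirror (R : Rule) : Rule where
  G := R.G.mirror
  β := R.β
  δ := R.δ
  r := R.r
  s := R.s
  t := R.t
  adj := R.adj

/-- The same rule with another value. -/
def Rule.withValue (R : Rule) (r : ℕ+) : Rule := { R with r := r }

/-- The same pass with another value. -/
def Pass.withValue (P : Pass) (r : ℕ+) : Pass := { P with r := r }

/-- The rule in which `δ` is replaced by `min δ 12`. -/
noncomputable def Rule.cap (R : Rule) : Rule := { R with δ := fun v => min (R.δ v) 12 }

open Classical in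
/-- The amount of charge that the rule `R` moves from the source to the sink of a pass with the same
configuration, source and sink as `P`. -/
noncomputable def Rule.effect (R : Rule) (P : Pass) : ℕ :=
  if (P.withValue R.r).Obeys R then (R.r : ℕ) else 0

/-- `R₁` and `R₂` together have the same net effect as `R`. -/
def Rule.SameNetEffect (R R₁ R₂ : Rule) : Prop :=
  ∀ P : Pass, R.effect P = R₁.effect P + R₂.effect P

/-- `𝓡'` is obtained from `𝓟` by replacing every rule that is not coherent by two coherent rules
with the same net effect. -/
def IsCoherentSplitting (𝓟 𝓡' : List Rule) : Prop :=
  ∃ f : Rule → List Rule, 𝓡' = 𝓟.flatMap f ∧ ∀ R ∈ 𝓟,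
    (R.Coherent ∧ f R = [R]) ∨
    (¬ R.Coherent ∧ ∃ R₁ R₂, f R = [R₁, R₂] ∧ R₁.Coherent ∧ R₂.Coherent ∧ R.SameNetEffect R₁ R₂)

open Classical in
/-- Add the mirror image of every non-symmetric rule. -/
noncomputable def addMirrors (L : List Rule) : List Rule :=
  L ++ (L.filter fun R => ¬ R.Symmetric).map Rule.mirror

/-- Replace every rule of value `r` by `r` identical rules of value one. -/
def unitRules (L : List Rule) : List Rule :=
  L.flatMap fun R => List.replicate (R.r : ℕ) (R.withValue 1)

/-- The rules obtained from the coherent rules `𝓡'` by adding mirror images, passing to rules of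
value one, and capping the upper bounds at 12. -/
noncomputable def modifiedRules (𝓡' : List Rule) : List Rule :=
  (unitRules (addMirrors 𝓡')).map Rule.cap

/-- `∑ (r(P) : P ≈ 𝓡, P appears in W, s(P) = x, t(P) = y)`; a pass is counted once for every member
of the list `𝓡` that it orientation-obeys. -/
noncomputable def orientSum (𝓡 : List Rule) (W : Configuration) (x y : W.G.V) : ℕ :=
  (𝓡.map fun R => passSum W x y fun P => P.OrientObeys R).sum

/-- The sum of `r(P)` over the passes that appear in `W` with source `x` and sink `y`; a pass is
counted once for every member of the list `𝓟` that it obeys. -/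
noncomputable def obeySum (𝓟 : List Rule) (W : Configuration) (x y : W.G.V) : ℕ :=
  (𝓟.map fun R => passSum W x y fun P => P.Obeys R).sum

/-- `∑ (r(P) : P ∼ 𝓟, P appears in W, s(P) = x, t(P) = y)`; a pass is counted once if it obeys a
member of `𝓟`. -/
noncomputable def obeySetSum (𝓟 : List Rule) (W : Configuration) (x y : W.G.V) : ℕ :=
  passSum W x y fun P => ∃ R ∈ 𝓟, P.Obeys R

end Discharging

namespace Discharging

open NearTriangulation

/-! Two passes that appear in `W` on the same vertex set `X` with the same ends and value differ
only by an orientation-preserving homeomorphism (`Pass.AppearsOn.exists_iso`), so they obey, and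
orientation-obey, the same rules. The sum attached to a single rule is therefore its value times the
number of vertex sets on which it applies, and every step of the construction becomes a count of
sets.

Splitting a rule preserves the sum because net effects agree set by set. For a symmetric coherent
rule, obeying and orientation-obeying coincide. For a non-symmetric rule, the sets for the rule and
for its mirror image are disjoint and together are those for obeying. Hence adding mirror images
turns "obeys" into "orientation-obeys". Unit rules only redistribute the factor `r`.

Capping can only lose passes having a vertex with `γ > 12`. Any pass counted before capping obeys,
up to its value, a member of `𝓟`. So its fans are bounded by assumption and its other vertices by
compatibility with the trivial axle. -/

/-! ### Darts, regions and connectedness of a drawing. -/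

theorem mapDart_trans {V V' V'' : Type} {G : SimpleGraph V} {G' : SimpleGraph V'}
    {G'' : SimpleGraph V''} (f : G →g G') (g : G' →g G'') (k : G →g G'')
    (h : ∀ v, k v = g (f v)) (d : G.Dart) : k.mapDart d = g.mapDart (f.mapDart d) := by
  apply SimpleGraph.Dart.ext
  exact Prod.ext (h d.fst) (h d.snd)

theorem mapDart_injective {V V' : Type} {G : SimpleGraph V} {G' : SimpleGraph V'}
    (f : G →g G') (hf : Function.Injective f) : Function.Injective f.mapDart := by
  intro a b hab
  have h := congrArg SimpleGraph.Dart.toProd hab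
  apply SimpleGraph.Dart.ext
  exact Prod.ext (hf (congrArg Prod.fst h)) (hf (congrArg Prod.snd h))

theorem mapDart_symm {V V' : Type} {G : SimpleGraph V} {G' : SimpleGraph V'}
    (f : G →g G') (d : G.Dart) : f.mapDart d.symm = (f.mapDart d).symm := rfl

namespace NearTriangulation

theorem mem_outer_iff (G : NearTriangulation) {a b : G.graph.Dart} (ha : a ∈ G.outer) :
    b ∈ G.outer ↔ G.next.SameCycle a b := by
  obtain ⟨c, hc⟩ := G.outer_region
  have hca := (hc a).1 ha
  rw [hc b]
  exact ⟨fun h => hca.symm.trans h, fun h => hca.trans h⟩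

theorem next_apply (G : NearTriangulation) (d : G.graph.Dart) : G.next d = G.rot d.symm := rfl

theorem rot_fst (G : NearTriangulation) (d : G.graph.Dart) : (G.rot d).fst = d.fst :=
  ((G.rot_sameCycle d (G.rot d)).1 (Equiv.Perm.sameCycle_apply_right.2 (.refl _ _))).symm

/-- A nonempty set of darts that is closed under reversal and rotation contains all darts. -/
theorem darts_eq_univ (G : NearTriangulation) (S : Set G.graph.Dart) (hne : S.Nonempty)
    (hsymm : ∀ d ∈ S, d.symm ∈ S) (hrot : ∀ d ∈ S, G.rot d ∈ S) : S = Set.univ := by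
  -- By finiteness, darts in one cycle are joined by nonnegative powers of `rot`, so closure under
  -- `rot⁻¹` need not be assumed.
  have : Finite G.graph.Dart :=
    Finite.of_injective (fun d => d.toProd) fun _ _ h => SimpleGraph.Dart.ext _ _ h
  have hcyc : ∀ a ∈ S, ∀ b : G.graph.Dart, a.fst = b.fst → b ∈ S := by
    intro a ha b hab
    obtain ⟨n, -, hn⟩ := ((G.rot_sameCycle a b).2 hab).exists_pow_eq'
    rw [← hn]
    clear hn
    induction n with
    | zero => exact ha
    | succ n ih => rw [pow_succ', Equiv.Perm.mul_apply]; exact hrot _ ih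
  obtain ⟨a, ha⟩ := hne
  have hreach : ∀ v, ∃ b ∈ S, b.fst = v := by
    intro v
    suffices ∀ u, G.graph.Walk v u → u = a.fst → ∃ b ∈ S, b.fst = v by
      obtain ⟨p⟩ := G.connected.preconnected v a.fst
      exact this _ p rfl
    intro u p hu
    induction p with
    | nil => exact ⟨a, ha, hu.symm⟩
    | @cons u v' _ h p ih =>
      obtain ⟨b, hb, hbv⟩ := ih hu
      exact ⟨⟨(u, v'), h⟩, hsymm _ (hcyc b hb ⟨(v', u), h.symm⟩ hbv), rfl⟩
  ext d
  obtain ⟨b, hb, hbd⟩ := hreach d.fst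
  simpa using hcyc b hb d hbd

/-! ### Orientation and mirror images. -/

theorem OrientIso.trans {G H J : NearTriangulation} {h : G.graph ≃g H.graph}
    {k : H.graph ≃g J.graph} (hh : OrientIso h) (hk : OrientIso k) : OrientIso (G := G) (H := J) (h.trans k) := by
  have hc := mapDart_trans h.toHom k.toHom (SimpleGraph.Iso.toHom (h.trans k)) (fun _ => rfl)
  refine ⟨fun d => ?_, fun d => ?_⟩
  · rw [hc, hc, hk.1, hh.1]
  · rw [hc, hk.2, hh.2]

/-- This moves the inverse rotation of a mirror image from the target drawing to the source. -/
theorem perm_inv_semiconj_iff {α β : Type*} (f : Equiv.Perm α) (g : Equiv.Perm β) (k : α → β) :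
    (∀ a, g⁻¹ (k a) = k (f a)) ↔ ∀ a, g (k a) = k (f⁻¹ a) := by
  constructor
  · intro h a
    obtain ⟨b, rfl⟩ := f.surjective a
    rw [← h, Equiv.Perm.coe_inv, Equiv.Perm.coe_inv, Equiv.apply_symm_apply,
      Equiv.symm_apply_apply]
  · intro h a
    rw [Equiv.Perm.inv_eq_iff_eq, h, Equiv.Perm.coe_inv, Equiv.symm_apply_apply]

theorem orientIso_mirror_right_iff {G H : NearTriangulation} (h : G.graph ≃g H.graph) :
    OrientIso (G := G) (H := H.mirror) h ↔ AntiIso (G := G) (H := H) h :=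
  and_congr (perm_inv_semiconj_iff G.rot H.rot h.toHom.mapDart)
    ⟨fun k d => k d.symm, fun k d => k d.symm⟩

theorem antiIso_mirror_left_iff {G H : NearTriangulation} (h : G.graph ≃g H.graph) :
    AntiIso (G := G.mirror) (H := H) h ↔ OrientIso (G := G) (H := H) h := by
  refine and_congr ?_ Iff.rfl
  change (∀ d, H.rot _ = h.toHom.mapDart (G.rot⁻¹⁻¹ d)) ↔ _
  rw [inv_inv]
  rfl

/-- Reversing an outer dart and taking its successor or predecessor in the outer region gives a dart
at the original vertex, so the two notions of incidence agree. -/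
theorem onOuter_mirror (G : NearTriangulation) (v : G.V) :
    G.mirror.OnOuter v ↔ G.OnOuter v := by
  constructor
  · rintro ⟨d, hd, hv⟩
    refine ⟨G.next d.symm, (G.mem_outer_iff hd).2 (Equiv.Perm.sameCycle_apply_right.2 (.refl _ _)),
      ?_⟩
    exact (G.rot_fst _).trans hv
  · rintro ⟨d, hd, hv⟩
    refine ⟨(G.next⁻¹ d).symm, ?_, ?_⟩
    · exact (G.mem_outer_iff hd).2 (Equiv.Perm.sameCycle_symm_apply_right.2 (.refl _ _))
    · rw [← hv]
      have := G.rot_fst (G.next⁻¹ d).symm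
      rw [← next_apply, Equiv.Perm.coe_inv, Equiv.apply_symm_apply] at this
      exact this.symm

end NearTriangulation

/-- The mirror image of a configuration. -/
def Configuration.mirror (K : Configuration) : Configuration where
  G := K.G.mirror
  γ := K.γ
  components := K.components
  degrees v := ⟨fun h => (K.degrees v).1 (mt (onOuter_mirror K.G v).2 h),
    fun h => (K.degrees v).2.1 ((onOuter_mirror K.G v).1 h), (K.degrees v).2.2⟩
  ringSize := by
    have h : {v | K.G.mirror.OnOuter v ∧ (K.G.mirror.del v).Connected} =
        {v | K.G.OnOuter v ∧ (K.G.del v).Connected} :=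
      Set.ext fun v => and_congr (onOuter_mirror K.G v) Iff.rfl
    rw [h]
    exact K.ringSize

/-- The mirror image of a pass. -/
def Pass.mirror (P : Pass) : Pass where
  K := P.K.mirror
  r := P.r
  s := P.s
  t := P.t
  adj := P.adj

theorem orientObeys_mirror_iff (P : Pass) (R : Rule) :
    P.OrientObeys R.mirror ↔ P.AntiObeys R :=
  exists_congr fun h => and_congr (orientIso_mirror_right_iff (H := R.G) h) Iff.rfl

theorem Pass.mirror_antiObeys_iff (P : Pass) (R : Rule) :
    P.mirror.AntiObeys R ↔ P.OrientObeys R :=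
  exists_congr fun h => and_congr (antiIso_mirror_left_iff (G := P.K.G) h) Iff.rfl

theorem obeys_iff_orientObeys_or_mirror (P : Pass) (R : Rule) :
    P.Obeys R ↔ P.OrientObeys R ∨ P.OrientObeys R.mirror := by
  rw [orientObeys_mirror_iff]; rfl

theorem Pass.Obeys.r_eq {P : Pass} {R : Rule} (h : P.Obeys R) : P.r = R.r := by
  rcases h with ⟨_, _, h⟩ | ⟨_, _, h⟩ <;> exact h.1

theorem Pass.OrientObeys.r_eq {P : Pass} {R : Rule} (h : P.OrientObeys R) : P.r = R.r :=
  Pass.Obeys.r_eq (Or.inl h)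

theorem Pass.OrientObeys.withValue {P : Pass} {R : Rule} (h : P.OrientObeys R) (n : ℕ+) :
    (P.withValue n).OrientObeys (R.withValue n) := by
  obtain ⟨h, h1, h2⟩ := h
  exact ⟨h, h1, rfl, h2.2⟩

/-- Coherence supplies one implication; the other is the same implication for the mirror image of
the pass, since mirroring exchanges the two ways of obeying. -/
theorem Rule.Coherent.antiObeys_iff {R : Rule} (hR : R.Coherent) (hS : R.Symmetric) (P : Pass) :
    P.AntiObeys R ↔ P.OrientObeys R :=
  ⟨fun h => P.mirror_antiObeys_iff R |>.1 (hR.2 hS P.mirror h), hR.2 hS P⟩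

/-! ### An appearance is determined by its vertex set, ends and value. -/

/-- The first-return index of a permutation to a set is unique. -/
theorem first_return_unique {α : Type*} (f : Equiv.Perm α) (S : Set α) (a : α) {n m : ℕ}
    (hn : 0 < n) (hm : 0 < m) (hnS : (f ^ n) a ∈ S) (hmS : (f ^ m) a ∈ S)
    (hn' : ∀ k, 0 < k → k < n → (f ^ k) a ∉ S) (hm' : ∀ k, 0 < k → k < m → (f ^ k) a ∉ S) :
    n = m := by
  rcases lt_trichotomy n m with h | h | h
  · exact absurd hnS (hm' n hn h)
  · exact h
  · exact absurd hmS (hn' m hm h)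

/-- The regions of an induced subdrawing with an edge are not all finite regions of `W`. -/
theorem not_next_comm_of_finite_regions {K : NearTriangulation} {W : NearTriangulation}
    (e : K.graph ↪g W.graph) (a : K.graph.Dart)
    (h : ∀ d, e.toHom.mapDart d ∉ W.outer ∧
      W.next (e.toHom.mapDart d) = e.toHom.mapDart (K.next d)) :
    False := by
  have huniv := W.darts_eq_univ (Set.range e.toHom.mapDart) ⟨_, a, rfl⟩
    (by rintro _ ⟨d, rfl⟩; exact ⟨d.symm, rfl⟩)
    (by
      rintro _ ⟨d, rfl⟩
      -- Rotation at `d` is `next` at `d.symm`, so commuting with `next` closes the image under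
      -- rotation. The image is then all of `W`, including its outer darts.
      exact ⟨K.next d.symm, ((h d.symm).2).symm.trans (by rw [next_apply, mapDart_symm]; rfl)⟩)
  obtain ⟨b, hb⟩ := W.outer_region
  have hb' : b ∈ W.outer := (hb b).2 (.refl _ _)
  obtain ⟨d, rfl⟩ : b ∈ Set.range e.toHom.mapDart := huniv ▸ Set.mem_univ b
  exact (h d).1 hb'

/-- Two passes that appear on the same vertices with the same source and sink differ, apart from
their values, only by an orientation-preserving homeomorphism. -/
theorem Pass.AppearsOn.exists_iso {P P' : Pass} {W : Configuration} {X : Set W.G.V} {x y : W.G.V}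
    (hP : P.AppearsOn W X x y) (hP' : P'.AppearsOn W X x y) :
    ∃ φ : P.K.G.graph ≃g P'.K.G.graph, OrientIso φ ∧ φ P.s = P'.s ∧ φ P.t = P'.t ∧
      ∀ v, P'.K.γ (φ v) = P.K.γ v := by
  obtain ⟨e, ⟨hγ, hrot, hreg⟩, hX, hs, ht⟩ := hP
  obtain ⟨e', ⟨hγ', hrot', hreg'⟩, hX', hs', ht'⟩ := hP'
  -- The vertices of the two passes are matched when they have the same image in `X`.
  let ψ : P.K.G.V ≃ P'.K.G.V := (Equiv.ofInjective e e.injective).trans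
    ((Equiv.setCongr (hX.trans hX'.symm)).trans (Equiv.ofInjective e' e'.injective).symm)
  have hψ : ∀ v, e' (ψ v) = e v := fun v => by
    have := Equiv.apply_ofInjective_symm e'.injective
      (Equiv.setCongr (hX.trans hX'.symm) (Equiv.ofInjective e e.injective v))
    exact this
  let φ : P.K.G.graph ≃g P'.K.G.graph := ⟨ψ, fun {a b} => by
    rw [← e'.map_adj_iff, hψ, hψ, e.map_adj_iff]⟩
  have hφ : ∀ v, e' (φ v) = e v := hψ
  have hd : ∀ d, e.toHom.mapDart d = e'.toHom.mapDart (φ.toHom.mapDart d) :=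
    mapDart_trans φ.toHom e'.toHom e.toHom fun v => (hφ v).symm
  have hsurj : Function.Surjective φ.toHom.mapDart := fun d =>
    ⟨φ.symm.toHom.mapDart d, by
      apply SimpleGraph.Dart.ext
      exact Prod.ext (φ.apply_symm_apply d.fst) (φ.apply_symm_apply d.snd)⟩
  have hrange : Set.range e'.toHom.mapDart = Set.range e.toHom.mapDart := by
    rw [funext hd]
    exact (hsurj.range_comp e'.toHom.mapDart).symm
  have hinj := mapDart_injective e'.toHom e'.injective
  have hφrot : ∀ d, P'.K.G.rot (φ.toHom.mapDart d) = φ.toHom.mapDart (P.K.G.rot d) := by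
    intro d
    apply hinj
    obtain ⟨n, hn, hn1, hn2⟩ := hrot d
    obtain ⟨m, hm, hm1, hm2⟩ := hrot' (φ.toHom.mapDart d)
    rw [← hd] at hm1 hm2
    rw [hrange] at hm2
    -- Both rotations are the first return of the rotation of `W` to the same set of darts.
    have hnm : n = m := first_return_unique W.G.rot (Set.range e.toHom.mapDart)
      (e.toHom.mapDart d) hn hm (hn1 ▸ ⟨_, rfl⟩) (hm1 ▸ hrange ▸ ⟨_, rfl⟩) hn2 hm2
    rw [← hd, ← hm1, ← hn1, hnm]
  have hφnext : ∀ d, P'.K.G.next (φ.toHom.mapDart d) = φ.toHom.mapDart (P.K.G.next d) :=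
    fun d => hφrot d.symm
  refine ⟨φ, ⟨hφrot, ?_⟩, e'.injective ((hφ _).trans (hs.trans hs'.symm)),
    e'.injective ((hφ _).trans (ht.trans ht'.symm)), fun v => by rw [hγ', hφ, hγ]⟩
  -- One dart that is outer in both passes suffices: each outer set is its orbit under `next`, and
  -- `φ` carries `next` to `next`.
  by_cases hcap : ∃ a, a ∈ P.K.G.outer ∧ φ.toHom.mapDart a ∈ P'.K.G.outer
  · obtain ⟨a, ha, ha'⟩ := hcap
    intro d
    rw [mem_outer_iff _ ha, mem_outer_iff _ ha']
    let F : P.K.G.graph.Dart ≃ P'.K.G.graph.Dart := Equiv.ofBijective φ.toHom.mapDart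
      ⟨mapDart_injective φ.toHom φ.injective, hsurj⟩
    have hpow : ∀ (n : ℤ) b, (P'.K.G.next ^ n) (F b) = F ((P.K.G.next ^ n) b) := by
      have hnext : P'.K.G.next = F.permCongr P.K.G.next := by
        ext1 b
        obtain ⟨c, rfl⟩ := F.surjective b
        rw [Equiv.permCongr_apply, Equiv.symm_apply_apply]
        exact hφnext c
      intro n b
      rw [hnext, ← Equiv.permCongrHom_coe, ← map_zpow, Equiv.permCongrHom_coe,
        Equiv.permCongr_apply, Equiv.symm_apply_apply]
    refine exists_congr fun n => ?_
    change (P'.K.G.next ^ n) (F a) = F d ↔ _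
    rw [hpow, F.apply_eq_iff_eq]
  -- Otherwise every dart bounds a finite region in one of the two passes, hence a finite region of
  -- `W`, which is impossible.
  · exfalso
    refine not_next_comm_of_finite_regions e ⟨(P.s, P.t), P.adj⟩ fun d => ?_
    by_cases h : d ∈ P.K.G.outer
    · have h2 := hreg' (φ.toHom.mapDart d) fun h2 => hcap ⟨d, h, h2⟩
      rwa [← hd, hφnext, ← hd] at h2
    · exact hreg d h

theorem Pass.AppearsOn.orientObeys {P P' : Pass} {W : Configuration} {X : Set W.G.V} {x y : W.G.V}
    (hP : P.AppearsOn W X x y) (hP' : P'.AppearsOn W X x y) (hr : P.r = P'.r) {R : Rule}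
    (h : P'.OrientObeys R) : P.OrientObeys R := by
  obtain ⟨φ, hφ, hs, ht, hγ⟩ := hP.exists_iso hP'
  obtain ⟨h, h1, h2, h3, h4, h5⟩ := h
  refine ⟨φ.trans h, hφ.trans h1, hr.trans h2, ?_, ?_, fun v => ?_⟩
  · exact (congrArg h hs).trans h3
  · exact (congrArg h ht).trans h4
  · rw [← hγ v]
    exact h5 (φ v)

theorem Pass.AppearsOn.obeys {P P' : Pass} {W : Configuration} {X : Set W.G.V} {x y : W.G.V}
    (hP : P.AppearsOn W X x y) (hP' : P'.AppearsOn W X x y) (hr : P.r = P'.r) {R : Rule}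
    (h : P'.Obeys R) : P.Obeys R := by
  rw [obeys_iff_orientObeys_or_mirror] at h ⊢
  exact h.imp (hP.orientObeys hP' hr) (hP.orientObeys hP' hr)

/-! ### Sums over passes as counts of vertex sets. -/

/-- The vertex sets on which passes with property `p` appear. -/
def appearanceSets (W : Configuration) (x y : W.G.V) (p : Pass → Prop) : Set (Set W.G.V) :=
  {X | ∃ P : Pass, p P ∧ P.AppearsOn W X x y}

theorem passSum_eq_mul_ncard (W : Configuration) (x y : W.G.V) {p : Pass → Prop} {r : ℕ+}
    (hp : ∀ P, p P → P.r = r) : passSum W x y p = r * (appearanceSets W x y p).ncard := by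
  have h : {q : Set W.G.V × ℕ+ | ∃ P : Pass, p P ∧ P.r = q.2 ∧ P.AppearsOn W q.1 x y} =
      (fun X => (X, r)) '' appearanceSets W x y p := by
    ext ⟨X, n⟩
    constructor
    · rintro ⟨P, hP, hn, hX⟩
      exact ⟨X, ⟨P, hP, hX⟩, Prod.ext rfl ((hp P hP).symm.trans hn)⟩
    · rintro ⟨X', ⟨P, hP, hX⟩, hX'⟩
      obtain ⟨rfl, rfl⟩ := Prod.mk.inj hX'
      exact ⟨P, hP, hp P hP, hX⟩
  have hinj : Function.Injective fun X : Set W.G.V => (X, r) := fun _ _ h => (Prod.mk.inj h).1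
  rw [passSum, h, finsum_mem_image hinj.injOn,
    finsum_mem_eq_finite_toFinset_sum _ (Set.toFinite (appearanceSets W x y p)),
    Set.ncard_eq_toFinset_card _ (Set.toFinite _)]
  exact (Finset.sum_const (r : ℕ)).trans (mul_comm _ _)

-- Spreading the count over all sets allows rules to be compared one vertex set at a time.
open Classical in
theorem mul_ncard_eq_finsum {α : Type*} [Finite α] (S : Set α) (r : ℕ) :
    r * S.ncard = ∑ᶠ a, if a ∈ S then r else 0 := by
  have := Fintype.ofFinite α
  rw [finsum_eq_sum_of_fintype, ← Finset.sum_filter, Finset.sum_const, smul_eq_mul, mul_comm,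
    Set.ncard_eq_toFinset_card', ← Set.filter_mem_univ_eq_toFinset]

theorem appearanceSets_withValue (W : Configuration) (x y : W.G.V) (R : Rule) (n : ℕ+) :
    appearanceSets W x y (fun P => P.OrientObeys (R.withValue n)) =
      appearanceSets W x y fun P => P.OrientObeys R := by
  ext X
  constructor
  · rintro ⟨P, hP, hX⟩
    exact ⟨P.withValue R.r, hP.withValue R.r, hX⟩
  · rintro ⟨P, hP, hX⟩
    exact ⟨P.withValue n, hP.withValue n, hX⟩

theorem passSum_orientObeys (W : Configuration) (x y : W.G.V) (R : Rule) :
    passSum W x y (fun P => P.OrientObeys R) =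
      R.r * (appearanceSets W x y fun P => P.OrientObeys R).ncard :=
  passSum_eq_mul_ncard W x y fun _ h => h.r_eq

theorem passSum_obeys (W : Configuration) (x y : W.G.V) (R : Rule) :
    passSum W x y (fun P => P.Obeys R) =
      R.r * (appearanceSets W x y fun P => P.Obeys R).ncard :=
  passSum_eq_mul_ncard W x y fun _ h => h.r_eq

theorem passSum_withValue_one (W : Configuration) (x y : W.G.V) (R : Rule) :
    (R.r : ℕ) * passSum W x y (fun P => P.OrientObeys (R.withValue 1)) =
      passSum W x y fun P => P.OrientObeys R := by
  rw [passSum_orientObeys, passSum_orientObeys, appearanceSets_withValue]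
  exact congrArg _ (one_mul _)

theorem passSum_obeys_of_symmetric (W : Configuration) (x y : W.G.V) {R : Rule} (hR : R.Coherent)
    (hS : R.Symmetric) :
    passSum W x y (fun P => P.Obeys R) = passSum W x y fun P => P.OrientObeys R := by
  congr 1
  funext P
  exact propext ((or_congr_right (hR.antiObeys_iff hS P)).trans (or_self_iff))

/-- A vertex set common to the rule and its mirror image would carry a pass obeying the rule in both
orientations, making it symmetric. -/
theorem passSum_obeys_of_not_symmetric (W : Configuration) (x y : W.G.V) {R : Rule}
    (hS : ¬ R.Symmetric) :
    passSum W x y (fun P => P.Obeys R) = (passSum W x y fun P => P.OrientObeys R) +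
      passSum W x y fun P => P.OrientObeys R.mirror := by
  have hunion : appearanceSets W x y (fun P => P.Obeys R) =
      appearanceSets W x y (fun P => P.OrientObeys R) ∪
        appearanceSets W x y fun P => P.OrientObeys R.mirror := by
    ext X
    simp only [appearanceSets, obeys_iff_orientObeys_or_mirror, or_and_right, exists_or,
      Set.mem_ofPred_eq, Set.mem_union]
  have hdisj : Disjoint (appearanceSets W x y fun P => P.OrientObeys R)
      (appearanceSets W x y fun P => P.OrientObeys R.mirror) := by
    rw [Set.disjoint_left]
    rintro X ⟨P, hP, hX⟩ ⟨P', hP', hX'⟩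
    refine hS ⟨P, hP, (orientObeys_mirror_iff P R).1 (hX.orientObeys hX' ?_ hP')⟩
    exact hP.r_eq.trans hP'.r_eq.symm
  rw [passSum_obeys, passSum_orientObeys, passSum_orientObeys, hunion,
    Set.ncard_union_eq hdisj (Set.toFinite _) (Set.toFinite _), mul_add]
  rfl

/-! ### Net effect and coherent splittings. -/

/-- The effect of a rule on a pass that appears on `X` is its contribution for `X`. -/
theorem effect_eq_of_appearsOn {W : Configuration} {x y : W.G.V} {X : Set W.G.V} {P : Pass}
    (hX : P.AppearsOn W X x y) (R : Rule) [Decidable (X ∈ appearanceSets W x y fun P => P.Obeys R)] :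
    R.effect P = if X ∈ appearanceSets W x y (fun P => P.Obeys R) then (R.r : ℕ) else 0 := by
  unfold Rule.effect
  refine ite_congr (propext ⟨fun h => ⟨P.withValue R.r, h, hX⟩, ?_⟩) (fun _ => rfl) fun _ => rfl
  rintro ⟨P', hP', hX'⟩
  exact Pass.AppearsOn.obeys (P := P.withValue R.r) hX hX' hP'.r_eq.symm hP'

theorem Rule.SameNetEffect.passSum_eq {R R₁ R₂ : Rule} (h : R.SameNetEffect R₁ R₂)
    (W : Configuration) (x y : W.G.V) :
    passSum W x y (fun P => P.Obeys R) = (passSum W x y fun P => P.Obeys R₁) +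
      passSum W x y fun P => P.Obeys R₂ := by
  classical
  simp only [passSum_obeys, mul_ncard_eq_finsum]
  rw [← finsum_add_distrib (Set.toFinite _) (Set.toFinite _)]
  refine finsum_congr fun X => ?_
  -- Any pass on `X` may test the net effect; if there is none, all three terms vanish.
  by_cases hX : ∃ P : Pass, P.AppearsOn W X x y
  · obtain ⟨P, hP⟩ := hX
    rw [← effect_eq_of_appearsOn hP, ← effect_eq_of_appearsOn hP, ← effect_eq_of_appearsOn hP]
    exact h P
  · have hR : ∀ R : Rule, X ∉ appearanceSets W x y fun P => P.Obeys R :=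
      fun R ⟨P, _, hP⟩ => hX ⟨P, hP⟩
    simp only [if_neg (hR _)]

theorem effect_ne_zero_iff (R : Rule) (P : Pass) :
    R.effect P ≠ 0 ↔ (P.withValue R.r).Obeys R := by
  unfold Rule.effect
  split_ifs with h
  · exact ⟨fun _ => h, fun _ => R.r.pos.ne'⟩
  · exact ⟨fun h => (h rfl).elim, fun h' => (h h').elim⟩

theorem Pass.Obeys.withValue_self {P : Pass} {R : Rule} (h : P.Obeys R) :
    (P.withValue R.r).Obeys R := by
  rw [← h.r_eq]; exact h

/-- A pass that obeys a rule of a coherent splitting obeys, apart from its value, one of the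
original rules. -/
theorem IsCoherentSplitting.exists_obeys {𝓟 𝓡' : List Rule} (hsplit : IsCoherentSplitting 𝓟 𝓡')
    {R : Rule} (hR : R ∈ 𝓡') {P : Pass} (hP : P.Obeys R) :
    ∃ R₀ ∈ 𝓟, (P.withValue R₀.r).Obeys R₀ := by
  obtain ⟨f, rfl, hf⟩ := hsplit
  obtain ⟨R₀, hR₀, hRf⟩ := List.mem_flatMap.1 hR
  refine ⟨R₀, hR₀, ?_⟩
  have hPR := (effect_ne_zero_iff R P).2 hP.withValue_self
  rcases hf R₀ hR₀ with ⟨-, h⟩ | ⟨-, R₁, R₂, h, -, -, hnet⟩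
  · rw [h, List.mem_singleton] at hRf
    exact hRf ▸ hP.withValue_self
  · rw [← effect_ne_zero_iff, hnet P]
    rw [h, List.mem_pair] at hRf
    rcases hRf with rfl | rfl <;> omega

theorem IsCoherentSplitting.coherent {𝓟 𝓡' : List Rule} (hsplit : IsCoherentSplitting 𝓟 𝓡')
    {R : Rule} (hR : R ∈ 𝓡') : R.Coherent := by
  obtain ⟨f, rfl, hf⟩ := hsplit
  obtain ⟨R₀, hR₀, hRf⟩ := List.mem_flatMap.1 hR
  rcases hf R₀ hR₀ with ⟨hc, h⟩ | ⟨-, R₁, R₂, h, h₁, h₂, -⟩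
  · rw [h, List.mem_singleton] at hRf
    exact hRf ▸ hc
  · rw [h, List.mem_pair] at hRf
    rcases hRf with rfl | rfl <;> assumption

/-! ### Sums over the successive lists of rules. -/

theorem sum_map_flatMap {α β : Type*} (l : List α) (f : α → List β) (g : β → ℕ) :
    ((l.flatMap f).map g).sum = (l.map fun a => ((f a).map g).sum).sum := by
  induction l with
  | nil => rfl
  | cons a l ih => simp [ih]

theorem IsCoherentSplitting.obeySum_eq {𝓟 𝓡' : List Rule} (hsplit : IsCoherentSplitting 𝓟 𝓡')
    (W : Configuration) (x y : W.G.V) : obeySum 𝓡' W x y = obeySum 𝓟 W x y := by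
  obtain ⟨f, rfl, hf⟩ := hsplit
  rw [obeySum, obeySum, sum_map_flatMap]
  congr 1
  refine List.map_congr_left fun R hR => ?_
  rcases hf R hR with ⟨-, h⟩ | ⟨-, R₁, R₂, h, -, -, hnet⟩
  · rw [h, List.map_singleton, List.sum_singleton]
  · rw [h, hnet.passSum_eq]
    simp

theorem orientSum_unitRules (L : List Rule) (W : Configuration) (x y : W.G.V) :
    orientSum (unitRules L) W x y = orientSum L W x y := by
  rw [orientSum, orientSum, unitRules, sum_map_flatMap]
  congr 1
  refine List.map_congr_left fun R _ => ?_
  rw [List.map_replicate, List.sum_replicate, smul_eq_mul, passSum_withValue_one]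

theorem orientSum_addMirrors {L : List Rule} (hL : ∀ R ∈ L, R.Coherent) (W : Configuration)
    (x y : W.G.V) : orientSum (addMirrors L) W x y = obeySum L W x y := by
  induction L with
  | nil => rfl
  | cons R L ih =>
    have ih := ih fun R' hR' => hL R' (List.mem_cons_of_mem _ hR')
    simp only [orientSum, obeySum, addMirrors, List.map_append, List.sum_append, List.map_map,
      List.filter_cons, List.map_cons, List.sum_cons] at ih ⊢
    rw [← ih]
    by_cases hS : R.Symmetric
    · rw [passSum_obeys_of_symmetric W x y (hL R List.mem_cons_self) hS]
      simp [hS, add_assoc]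
    · rw [passSum_obeys_of_not_symmetric W x y hS]
      simp only [hS, not_false_eq_true, decide_true, if_true, List.map_cons, List.sum_cons,
        Function.comp_apply]
      omega

/-! ### Capping the upper bounds at 12. -/

theorem Pass.OrientObeys.of_cap {P : Pass} {R : Rule} (h : P.OrientObeys R.cap) :
    P.OrientObeys R := by
  obtain ⟨h, h1, h2, h3, h4, h5⟩ := h
  exact ⟨h, h1, h2, h3, h4, fun v => ⟨(h5 v).1, (h5 v).2.trans (min_le_left _ _)⟩⟩

theorem Pass.OrientObeys.cap {P : Pass} {R : Rule} (h : P.OrientObeys R)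
    (hγ : ∀ v, P.K.γ v ≤ 12) : P.OrientObeys R.cap := by
  obtain ⟨h, h1, h2, h3, h4, h5⟩ := h
  exact ⟨h, h1, h2, h3, h4, fun v => ⟨(h5 v).1, le_min (h5 v).2 (by exact_mod_cast hγ v)⟩⟩

theorem Pass.AppearsOn.γ_le {P : Pass} {W : Configuration} {X : Set W.G.V} {x y : W.G.V}
    (h : P.AppearsOn W X x y) {n : ℕ} (hX : ∀ v ∈ X, W.γ v ≤ n) (v : P.K.G.V) : P.K.γ v ≤ n := by
  obtain ⟨e, he, rfl, -⟩ := h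
  rw [he.1]
  exact hX _ ⟨v, rfl⟩

/-- Capping is harmless when all passes that count have degrees at most 12. -/
theorem orientSum_cap {L : List Rule} {W : Configuration} {x y : W.G.V}
    (h : ∀ R ∈ L, ∀ (P : Pass) (X : Set W.G.V), P.OrientObeys R → P.AppearsOn W X x y →
      ∀ v ∈ X, W.γ v ≤ 12) :
    orientSum (L.map Rule.cap) W x y = orientSum L W x y := by
  rw [orientSum, orientSum, List.map_map]
  congr 1
  refine List.map_congr_left fun R hR => ?_
  have hcap : appearanceSets W x y (fun P => P.OrientObeys R.cap) =
      appearanceSets W x y fun P => P.OrientObeys R := by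
    ext X
    exact exists_congr fun P => ⟨fun hP => ⟨hP.1.of_cap, hP.2⟩,
      fun hP => ⟨hP.1.cap (hP.2.γ_le (h R hR P X hP.1 hP.2)), hP.2⟩⟩
  rw [Function.comp_apply, passSum_orientObeys, passSum_orientObeys, hcap]
  rfl

/-- Together with `IsCoherentSplitting.exists_obeys`, this traces a pass back to `𝓟`, where the
degree bound is assumed. Only the value may change, and it does not affect the vertex set. -/
theorem exists_obeys_of_mem_unitRules_addMirrors {L : List Rule} {R : Rule}
    (hR : R ∈ unitRules (addMirrors L)) {P : Pass} (hP : P.OrientObeys R) :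
    ∃ R' ∈ L, (P.withValue R'.r).Obeys R' := by
  obtain ⟨R₁, hR₁, hR⟩ := List.mem_flatMap.1 hR
  obtain rfl := List.eq_of_mem_replicate hR
  have hP₁ : (P.withValue R₁.r).OrientObeys R₁ := hP.withValue R₁.r
  rcases List.mem_append.1 hR₁ with h | h
  · exact ⟨R₁, h, Or.inl hP₁⟩
  · obtain ⟨R', hR', rfl⟩ := List.mem_map.1 h
    exact ⟨R', List.mem_of_mem_filter hR', Or.inr ((orientObeys_mirror_iff _ _).1 hP₁)⟩

theorem orientSum_modifiedRules {𝓟 𝓡' : List Rule} (hsplit : IsCoherentSplitting 𝓟 𝓡')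
    {W : Configuration} {x y : W.G.V}
    (h : ∀ (P : Pass) (X : Set W.G.V), (∃ R ∈ 𝓟, P.Obeys R) → P.AppearsOn W X x y →
      ∀ v ∈ X, W.γ v ≤ 12) :
    orientSum (modifiedRules 𝓡') W x y = obeySum 𝓟 W x y := by
  rw [modifiedRules, orientSum_cap, orientSum_unitRules,
    orientSum_addMirrors fun R hR => hsplit.coherent hR, hsplit.obeySum_eq]
  intro R hR P X hP hX
  obtain ⟨R', hR', hP'⟩ := exists_obeys_of_mem_unitRules_addMirrors hR hP
  obtain ⟨R₀, hR₀, hP₀⟩ := hsplit.exists_obeys hR' hP'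
  exact h (P.withValue R₀.r) X ⟨R₀, hR₀, hP₀⟩ hX

/-! ### Counting each pass once, and the degree bound. -/

/-- If no pass obeys two members of the list, then counting each pass once makes no difference. -/
theorem obeySum_eq_obeySetSum {𝓟 : List Rule}
    (h : 𝓟.Pairwise fun R R' => ¬ ∃ P : Pass, P.Obeys R ∧ P.Obeys R') (W : Configuration)
    (x y : W.G.V) : obeySum 𝓟 W x y = obeySetSum 𝓟 W x y := by
  induction 𝓟 with
  | nil => simp [obeySum, obeySetSum, passSum]
  | cons R L ih =>
    have hR := (List.pairwise_cons.1 h).1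
    have ih := ih h.of_cons
    -- Finiteness is needed for the `finsum` to be additive; `ℕ+` is infinite, but only values of
    -- rules in the list occur.
    have hfin : ∀ L' : List Rule, {q : Set W.G.V × ℕ+ |
        ∃ P : Pass, (∃ R ∈ L', P.Obeys R) ∧ P.r = q.2 ∧ P.AppearsOn W q.1 x y}.Finite := by
      intro L'
      refine ((Set.finite_univ (α := Set W.G.V)).prod
        (L'.map Rule.r).finite_toSet).subset ?_
      rintro ⟨X, n⟩ ⟨P, ⟨R', hR', hP⟩, hn, -⟩
      refine ⟨Set.mem_univ _, List.mem_map.2 ⟨R', hR', ?_⟩⟩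
      exact hP.r_eq.symm.trans hn
    have hfinR := hfin [R]
    simp only [List.mem_singleton, exists_eq_left] at hfinR
    rw [obeySum, List.map_cons, List.sum_cons]
    change _ + obeySum L W x y = _
    rw [ih, obeySetSum, obeySetSum, passSum, passSum, passSum,
      ← finsum_mem_union ?_ hfinR (hfin L)]
    · refine finsum_mem_congr (Set.ext fun q => ?_) fun _ _ => rfl
      simp only [List.mem_cons, exists_eq_left, or_and_right, exists_or, Set.mem_union,
        Set.mem_ofPred_eq]
    · rw [Set.disjoint_left]
      rintro ⟨X, n⟩ ⟨P, hP, hn, hX⟩ ⟨P', ⟨R', hR', hP'⟩, hn', hX'⟩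
      -- Two passes sharing `X` and value obey the same rules, so `P` would obey both `R` and `R'`.
      exact hR R' hR' ⟨P, hP, hX.obeys hX' (hn.trans hn'.symm) hP'⟩

/-- In a cartwheel compatible with the trivial axle, the vertices other than the fans have
degree at most 12. -/
theorem Compatible.γ_le {d : ℕ} (hd : d ≤ 12) {W : Configuration} {w : W.G.V}
    (hc : Compatible W w (trivialAxle d)) {v : W.G.V} (hv : ¬ IsFan W w v) : W.γ v ≤ 12 := by
  obtain ⟨lab, -, hw, -, hspoke, -, hhat, -, -, hbound⟩ := hc
  by_cases hvw : v = w
  · rw [hvw, hw]; exact hd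
  by_cases hs : IsSpoke W w v
  · obtain ⟨i, h1, h2, rfl⟩ := (hspoke v).1 hs
    exact (hbound i (Or.inl ⟨h1, by omega⟩)).2
  by_cases hh : IsHat W w v
  · obtain ⟨i, h1, h2, rfl⟩ := (hhat v).1 hh
    exact (hbound (d + i) (Or.inl ⟨by omega, by omega⟩)).2
  · exact absurd ⟨hvw, hs, hh⟩ hv

end Discharging
theorem mainTheorem8 (𝓟 𝓡' : List Discharging.Rule)
    (hsplit : Discharging.IsCoherentSplitting 𝓟 𝓡')
    (d : ℕ) (hd : 5 ≤ d) (hd12 : d ≤ 12)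
    (W : Discharging.Configuration) (w s : W.G.V)
    (hW : Discharging.IsCartwheel W w)
    (hc : Discharging.Compatible W w (Discharging.trivialAxle d))
    (hs : Discharging.IsSpoke W w s)
    (hfan : ∀ (P : Discharging.Pass) (X : Set W.G.V), (∃ R ∈ 𝓟, P.Obeys R) →
      (P.AppearsOn W X s w ∨ P.AppearsOn W X w s) →
      ∀ v ∈ X, Discharging.IsFan W w v → W.γ v ≤ 12) :
    (Discharging.orientSum (Discharging.modifiedRules 𝓡') W s w = Discharging.obeySum 𝓟 W s w ∧
      Discharging.orientSum (Discharging.modifiedRules 𝓡') W w s = Discharging.obeySum 𝓟 W w s) ∧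
    (𝓟.Pairwise (fun R R' => ¬ ∃ P : Discharging.Pass, P.Obeys R ∧ P.Obeys R') →
      Discharging.orientSum (Discharging.modifiedRules 𝓡') W s w
          = Discharging.obeySetSum 𝓟 W s w ∧
        Discharging.orientSum (Discharging.modifiedRules 𝓡') W w s
          = Discharging.obeySetSum 𝓟 W w s) := by
  have h : ∀ x y, (x = s ∧ y = w ∨ x = w ∧ y = s) →
      Discharging.orientSum (Discharging.modifiedRules 𝓡') W x y = Discharging.obeySum 𝓟 W x y := by
    intro x y hxy
    refine Discharging.orientSum_modifiedRules hsplit fun P X hP hX v hv => ?_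
    by_cases hf : Discharging.IsFan W w v
    · refine hfan P X hP ?_ v hv hf
      rcases hxy with ⟨rfl, rfl⟩ | ⟨rfl, rfl⟩
      exacts [Or.inl hX, Or.inr hX]
    · exact hc.γ_le hd12 hf
  have h1 := h s w (Or.inl ⟨rfl, rfl⟩)
  have h2 := h w s (Or.inr ⟨rfl, rfl⟩)
  refine ⟨⟨h1, h2⟩, fun hpair => ?_⟩
  rw [h1, h2]
  exact ⟨Discharging.obeySum_eq_obeySetSum hpair W s w,
    Discharging.obeySum_eq_obeySetSum hpair W w s⟩
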